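/- Let $k$ be an algebraically closed field, $Q=(Q_0,Q_1,s,t)$ a finite quiver, and $I$ a two-sided ideal of the path algebra $kQ$ that is homogeneous for the grading of $kQ$ by path length. Let $M=((M_i)_{i\in Q_0},(f_\alpha)_{\alpha\in Q_1})$ be a finite-dimensional representation of $Q$ over $k$ on which every element of $I$ acts as zero, with dimension vector $d=(\dim_k M_i)_{i\in Q_0}$. Let $\mathrm{rep}(Q,d)=\prod_{\alpha\in Q_1}\mathrm{Hom}_k(k^{d_{s(\alpha)}},k^{d_{t(\alpha)}})$, an affine space with the Zariski topology, let $O_M\subseteq \mathrm{rep}(Q,d)$ be the set of all points $n$ whose associated representation $N$ (with $N_i=k^{d_i}$) is isomorphic to $M$, and let $\overline{O}_M$ be its closure. For $\lambda\in k$ let $\lambda M$ be the representation $((M_i)_{i\in Q_0},(\lambda f_\alpha)_{\alpha\in Q_1})$, which again satisfies the relations in $I$. Then $\overline{O}_M$ is an affine cone, that is, for every $n\in\overline{O}_M$ it contains the subspace $kn$ spanned by $n$, if and only if $\lambda M\cong M$ for every $\lambda\in k$ with $\lambda\neq 0$. -/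

import Mathlib

noncomputable section

namespace QuiverCone

open Quiver

universe u v w w' x

/-- A path of `Q` together with its source and its target. -/
abbrev AnyPath (Q : Type u) [Quiver.{v} Q] := Σ a b : Q, Path a b

/-- The underlying vector space of the path algebra `kQ`: its basis is the set of all paths of `Q`,
the trivial paths included. -/
abbrev PathAlgebra (k : Type x) [Field k] (Q : Type u) [Quiver.{v} Q] := AnyPath Q →₀ k

section PathAlgebra

variable {k : Type x} [Field k] {Q : Type u} [Quiver.{v} Q]

open Classical in
/-- The product of two paths in `kQ`: their concatenation (first `p`, then `q`) if `p` ends where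
`q` starts, and `0` otherwise. -/
def pathMul (p q : AnyPath Q) : PathAlgebra k Q :=
  if h : p.2.1 = q.1 then
    Finsupp.single ⟨p.1, q.2.1, p.2.2.comp (q.2.2.cast h.symm rfl)⟩ 1
  else 0

/-- The multiplication of `kQ`, the bilinear extension of the product of paths. -/
def PathAlgebra.mul (x y : PathAlgebra k Q) : PathAlgebra k Q :=
  x.sum fun p c => y.sum fun q c' => (c * c') • pathMul p q

end PathAlgebra

/-- A two-sided ideal of the path algebra `kQ` that is homogeneous for the grading of `kQ` by the
length of paths: it contains every homogeneous component of each of its elements. -/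
structure HomogeneousIdeal (k : Type x) [Field k] (Q : Type u) [Quiver.{v} Q] where
  carrier : Submodule k (PathAlgebra k Q)
  mul_mem_left : ∀ x y : PathAlgebra k Q, y ∈ carrier → PathAlgebra.mul x y ∈ carrier
  mul_mem_right : ∀ x y : PathAlgebra k Q, x ∈ carrier → PathAlgebra.mul x y ∈ carrier
  homogeneous : ∀ x ∈ carrier, ∀ n : ℕ, x.filter (fun p => p.2.2.length = n) ∈ carrier

/-- A finite-dimensional representation of the quiver `Q` over `k`. -/
structure QRep (k : Type x) [Field k] (Q : Type u) [Quiver.{v} Q] where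
  V : Q → Type w
  [addCommGroup : ∀ i, AddCommGroup (V i)]
  [module : ∀ i, Module k (V i)]
  [finite : ∀ i, FiniteDimensional k (V i)]
  map : ∀ {a b : Q}, (a ⟶ b) → (V a →ₗ[k] V b)

attribute [instance] QRep.addCommGroup QRep.module QRep.finite

namespace QRep

variable {k : Type x} [Field k] {Q : Type u} [Quiver.{v} Q]

/-- Morphisms of representations. -/
structure Hom (M : QRep.{u, v, w} k Q) (N : QRep.{u, v, w'} k Q) where
  app : ∀ i, M.V i →ₗ[k] N.V i
  comm : ∀ {a b : Q} (α : a ⟶ b), app b ∘ₗ M.map α = N.map α ∘ₗ app a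

/-- `M ≅ N`: there is a morphism `M → N` which is invertible at every vertex. -/
def Isomorphic (M : QRep.{u, v, w} k Q) (N : QRep.{u, v, w'} k Q) : Prop :=
  ∃ h : Hom M N, ∀ i, Function.Bijective (h.app i)

/-- The representation `tM`: the map of every arrow is multiplied by `t`. -/
def scale (t : k) (M : QRep.{u, v, w} k Q) : QRep.{u, v, w} k Q where
  V := M.V
  map α := t • M.map α

/-- The linear map by which a path acts: the composite of the maps of its arrows. -/
def pathMap (M : QRep.{u, v, w} k Q) {a : Q} : ∀ {b : Q}, Path a b → (M.V a →ₗ[k] M.V b)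
  | _, Path.nil => LinearMap.id
  | _, Path.cons p α => M.map α ∘ₗ M.pathMap p

open Classical in
/-- The action of a path from `a` to `b` on the total space of `M`: it sends the component at `a`
to the component at `b` through the map of the path, and kills the other components. -/
def pathAct (M : QRep.{u, v, w} k Q) (p : AnyPath Q) : Module.End k (∀ i, M.V i) :=
  LinearMap.single k M.V p.2.1 ∘ₗ M.pathMap p.2.2 ∘ₗ LinearMap.proj p.1

/-- The action of the path algebra on the total space of `M`. -/
def act (M : QRep.{u, v, w} k Q) : PathAlgebra k Q →ₗ[k] Module.End k (∀ i, M.V i) :=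
  Finsupp.linearCombination k M.pathAct

lemma pathMap_scale (t : k) (M : QRep.{u, v, w} k Q) {a b : Q} (p : Path a b) :
    (M.scale t).pathMap p = t ^ p.length • M.pathMap p := by
  induction p with
  | nil => simp only [Path.length_nil, pow_zero, one_smul]; rfl
  | cons p α ih =>
    change (t • M.map α) ∘ₗ (M.scale t).pathMap p = t ^ (p.length + 1) • (M.map α ∘ₗ M.pathMap p)
    rw [ih, pow_succ', mul_smul]
    refine LinearMap.ext fun v => ?_
    exact congrArg (t • ·) (map_smul (M.map α) (t ^ p.length) (M.pathMap p v))

lemma pathAct_scale (t : k) (M : QRep.{u, v, w} k Q) (p : AnyPath Q) :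
    (M.scale t).pathAct p = t ^ p.2.2.length • M.pathAct p := by
  classical
  unfold pathAct
  rw [pathMap_scale]
  refine LinearMap.ext fun v => ?_
  exact map_smul (LinearMap.single k M.V p.2.1) (t ^ p.2.2.length) (M.pathMap p.2.2 (v p.1))

lemma act_scale_filter (t : k) (M : QRep.{u, v, w} k Q) (y : PathAlgebra k Q) (n : ℕ) :
    (M.scale t).act (y.filter (fun p => p.2.2.length = n)) =
      t ^ n • M.act (y.filter (fun p => p.2.2.length = n)) := by
  unfold act
  rw [Finsupp.linearCombination_apply, Finsupp.linearCombination_apply, Finsupp.sum,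
    Finsupp.sum, Finset.smul_sum]
  refine Finset.sum_congr rfl fun p hp => ?_
  rw [Finsupp.support_filter, Finset.mem_filter] at hp
  rw [pathAct_scale, hp.2]
  exact smul_comm (y.filter (fun p => p.2.2.length = n) p) (t ^ n) (M.pathAct p)

lemma sum_filter_length (y : PathAlgebra k Q) :
    ∑ n ∈ y.support.image (fun p => p.2.2.length), y.filter (fun p => p.2.2.length = n) = y := by
  classical
  ext p
  rw [Finsupp.finsetSum_apply]
  simp only [Finsupp.filter_apply, Finset.sum_ite_eq]
  split_ifs with h
  · rfl
  · by_contra h'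
    exact h (Finset.mem_image_of_mem _ (Finsupp.mem_support_iff.2 (Ne.symm h')))

end QRep

/-- A finite-dimensional representation of the quiver `Q` bound by the ideal `I`: every element of
`I` acts on it as zero. -/
structure BoundRep {k : Type x} [Field k] {Q : Type u} [Quiver.{v} Q] (I : HomogeneousIdeal k Q)
    extends QRep.{u, v, w} k Q where
  relations : ∀ y ∈ I.carrier, toQRep.act y = 0

/-- The representation `tM` of the same bound quiver. -/
def BoundRep.scale {k : Type x} [Field k] {Q : Type u} [Quiver.{v} Q] {I : HomogeneousIdeal k Q}
    (t : k) (M : BoundRep.{u, v, w} I) : BoundRep.{u, v, w} I where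
  toQRep := M.toQRep.scale t
  relations y hy := by
    rw [← QRep.sum_filter_length y, map_sum]
    refine Finset.sum_eq_zero fun n _ => ?_
    rw [QRep.act_scale_filter, M.relations _ (I.homogeneous y hy n)]
    exact smul_zero (A := Module.End k (∀ i, M.V i)) (t ^ n)

/-- The Zariski topology on the affine space `k^σ`: the closed sets are the sets of common zeros of
the ideals of the polynomial ring. -/
abbrev zariskiTopology (k : Type x) [Field k] (σ : Type w) : TopologicalSpace (σ → k) :=
  TopologicalSpace.ofClosed
    {Z | ∃ J : Ideal (MvPolynomial σ k), Z = MvPolynomial.zeroLocus k J}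
    ⟨⊤, by rw [MvPolynomial.zeroLocus_top]; rfl⟩
    (by
      intro A hA
      refine ⟨MvPolynomial.vanishingIdeal k (⋂₀ A), Set.Subset.antisymm
        (MvPolynomial.zeroLocus_vanishingIdeal_le _) ?_⟩
      intro z hz Z hZ
      obtain ⟨J, rfl⟩ := hA hZ
      intro p hp
      exact hz p fun y hy => hy _ hZ p hp)
    (by
      rintro _ ⟨J, rfl⟩ _ ⟨K, rfl⟩
      refine ⟨J * K, Set.Subset.antisymm ?_ ?_⟩
      · exact Set.union_subset (MvPolynomial.zeroLocus_anti_mono Ideal.mul_le_left)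
          (MvPolynomial.zeroLocus_anti_mono Ideal.mul_le_right)
      · intro z hz
        by_contra h
        simp only [Set.mem_union, MvPolynomial.mem_zeroLocus_iff, not_or, not_forall] at h
        obtain ⟨⟨p, hp, hpz⟩, ⟨q, hq, hqz⟩⟩ := h
        have := hz (p * q) (Ideal.mul_mem_mul hp hq)
        rw [map_mul] at this
        exact (mul_ne_zero hpz hqz) this)

section RepSpace

variable {k : Type x} [Field k] {Q : Type u} [Quiver.{v} Q]

/-- The coordinates of the representation space for the dimension vector `d`: an arrow
`α : a ⟶ b`, a row index below `d b` and a column index below `d a`. -/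
abbrev Coord (d : Q → ℕ) := Σ a b : Q, (a ⟶ b) × Fin (d b) × Fin (d a)

/-- The affine space `rep(Q, d)`, the product over all arrows `α : a ⟶ b` of the spaces of
`d b × d a` matrices. -/
abbrev RepSpace (k : Type x) [Field k] (d : Q → ℕ) := Coord d → k

/-- The representation on the spaces `k ^ (d i)` defined by a point of `rep(Q, d)`. -/
def RepSpace.toQRep {d : Q → ℕ} (m : RepSpace k d) : QRep.{u, v, x} k Q where
  V i := Fin (d i) → k
  map {a b} α := Matrix.mulVecLin (Matrix.of fun i j => m ⟨a, b, α, i, j⟩)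

/-- The dimension vector of a representation. -/
def QRep.dimVec (M : QRep.{u, v, w} k Q) : Q → ℕ := fun i => Module.finrank k (M.V i)

/-- The orbit `O_M` in `rep(Q, d)`, where `d` is the dimension vector of `M`: the points whose
representation is isomorphic to `M`. -/
def QRep.orbit (M : QRep.{u, v, w} k Q) : Set (RepSpace k M.dimVec) :=
  {n | QRep.Isomorphic n.toQRep M}

/-- The closure of the orbit `O_M` in the Zariski topology of `rep(Q, d)`. -/
def QRep.orbitClosure (M : QRep.{u, v, w} k Q) : Set (RepSpace k M.dimVec) :=
  @closure _ (zariskiTopology k (Coord M.dimVec)) M.orbit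

/-- `M` is homogeneous if its orbit closure is an affine cone, that is, contains the line spanned
by each of its elements. -/
def QRep.IsHomogeneous (M : QRep.{u, v, w} k Q) : Prop :=
  ∀ n ∈ M.orbitClosure, (Submodule.span k {n} : Set (RepSpace k M.dimVec)) ⊆ M.orbitClosure

end RepSpace

end QuiverCone

end

/-! If `tM ≅ M` for all `t ≠ 0`, nonzero scalars preserve the orbit, hence its closure. A polynomial
vanishing on the orbit thus vanishes on `s • n` for all `s ≠ 0`, and, `k` being infinite, also for
`s = 0`.

Conversely, suppose the closure is a cone. The key fact, `exists_regular_of_mem_orbitClosure`, is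
that near the base point the closure contains only points of the orbit. If scaling by `t ≠ 0` sent
the whole orbit off this neighbourhood, it would do so to the closure too; but the closure contains
`t⁻¹` times the base point. So some `t • p` with `p` in the orbit lies in the orbit again, and `tM ≅
M`.

For the key fact, morphisms from `M` to the representation at `n` form the kernel of a linear map
depending polynomially on `n`. Its rank is constant on the orbit and, by semicontinuity, no larger
on the closure, so Cramer's rule extends the isomorphism at the base point to a regular family of
morphisms, invertible where certain determinants do not vanish. -/

namespace QuiverCone

open Quiver

universe u v w w' w'' x

/-! ### Polynomial functions and the Zariski closure. -/

section Regular

variable {k : Type x} [Field k] {σ : Type w}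

/-- A function on the affine space `k^σ` is regular if it is given by a polynomial. -/
def IsRegular (f : (σ → k) → k) : Prop :=
  ∃ p : MvPolynomial σ k, ∀ z, MvPolynomial.eval z p = f z

namespace IsRegular

lemma const (c : k) : IsRegular (fun _ : σ → k => c) := ⟨MvPolynomial.C c, by simp⟩

lemma coord (s : σ) : IsRegular (fun z : σ → k => z s) := ⟨MvPolynomial.X s, by simp⟩

lemma mul {f g : (σ → k) → k} (hf : IsRegular f) (hg : IsRegular g) :
    IsRegular (fun z => f z * g z) := by
  obtain ⟨p, hp⟩ := hf
  obtain ⟨q, hq⟩ := hg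
  exact ⟨p * q, fun z => by simp [hp, hq]⟩

lemma sub {f g : (σ → k) → k} (hf : IsRegular f) (hg : IsRegular g) :
    IsRegular (fun z => f z - g z) := by
  obtain ⟨p, hp⟩ := hf
  obtain ⟨q, hq⟩ := hg
  exact ⟨p - q, fun z => by simp [hp, hq]⟩

lemma sum {ι : Type*} (s : Finset ι) {f : ι → (σ → k) → k} (hf : ∀ i, IsRegular (f i)) :
    IsRegular (fun z => ∑ i ∈ s, f i z) := by
  choose p hp using hf
  exact ⟨∑ i ∈ s, p i, fun z => by simp [hp]⟩

lemma prod {ι : Type*} (s : Finset ι) {f : ι → (σ → k) → k} (hf : ∀ i, IsRegular (f i)) :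
    IsRegular (fun z => ∏ i ∈ s, f i z) := by
  choose p hp using hf
  exact ⟨∏ i ∈ s, p i, fun z => by simp [hp, map_prod]⟩

lemma det {ι : Type*} [Fintype ι] [DecidableEq ι] {B : (σ → k) → Matrix ι ι k}
    (hB : ∀ i j, IsRegular (fun z => B z i j)) : IsRegular (fun z => (B z).det) := by
  simp only [Matrix.det_apply']
  exact sum _ fun τ => (const _).mul (prod _ fun i => hB _ _)

lemma adjugate {ι : Type*} [Fintype ι] [DecidableEq ι] {B : (σ → k) → Matrix ι ι k}
    (hB : ∀ i j, IsRegular (fun z => B z i j)) (i j : ι) :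
    IsRegular (fun z => (B z).adjugate i j) := by
  simp only [Matrix.adjugate_apply]
  refine det fun a b => ?_
  simp only [Matrix.updateRow_apply]
  split_ifs
  · exact const _
  · exact hB a b

lemma linear [Finite σ] (l : (σ → k) →ₗ[k] k) : IsRegular (fun z => l z) := by
  classical
  have := Fintype.ofFinite σ
  have h : (fun z => l z) = fun z => ∑ i, z i * l (fun j => if i = j then 1 else 0) :=
    funext fun z => LinearMap.pi_apply_eq_sum_univ l z
  rw [h]
  exact sum _ fun i => (coord i).mul (const _)

lemma comp_smul {f : (σ → k) → k} (hf : IsRegular f) (t : k) :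
    IsRegular (fun z => f (t • z)) := by
  obtain ⟨p, hp⟩ := hf
  refine ⟨MvPolynomial.bind₁ (fun s => MvPolynomial.C t * MvPolynomial.X s) p, fun z => ?_⟩
  change _ = f (t • z)
  rw [← hp, MvPolynomial.eval, MvPolynomial.eval₂Hom_bind₁]
  simp only [map_mul, MvPolynomial.eval₂Hom_C, MvPolynomial.eval₂Hom_X', RingHom.id_apply]
  rfl

end IsRegular

/-- All later arguments use the topology only through this vanishing criterion. -/
lemma mem_closure_zariski_iff {S : Set (σ → k)} {z : σ → k} :
    z ∈ @closure _ (zariskiTopology k σ) S ↔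
      ∀ f : (σ → k) → k, IsRegular f → (∀ y ∈ S, f y = 0) → f z = 0 := by
  let _ := zariskiTopology k σ
  constructor
  · rintro hz f ⟨p, hp⟩ hS
    -- In `TopologicalSpace.ofClosed`, a set is open when its complement is in the given family,
    -- hence the double complement.
    have hcl : IsClosed (MvPolynomial.zeroLocus k (Ideal.span {p}) : Set (σ → k)) :=
      isOpen_compl_iff.1 ⟨_, compl_compl _⟩
    have := closure_minimal (s := S) (fun y hy => ?_) hcl hz
    · rw [MvPolynomial.mem_zeroLocus_iff] at this
      rw [← hp, ← MvPolynomial.aeval_eq_eval]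
      exact this p (Ideal.mem_span_singleton_self p)
    · rw [MvPolynomial.zeroLocus_span]
      rintro _ rfl
      rw [MvPolynomial.aeval_eq_eval]
      exact (hp y).trans (hS y hy)
  · intro h
    rintro Z ⟨hZ, hSZ⟩
    obtain ⟨J, hJ⟩ := isOpen_compl_iff.2 hZ
    rw [compl_compl] at hJ
    subst hJ
    intro p hp
    rw [MvPolynomial.aeval_eq_eval]
    exact h _ ⟨p, fun _ => rfl⟩ fun y hy => by
      simpa [MvPolynomial.aeval_eq_eval] using hSZ hy p hp

end Regular

/-! ### Rank and kernel of a regular family of linear maps. -/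

section KernelSection

variable {k : Type x} [Field k] {V : Type w} {W : Type w'} [AddCommGroup V] [Module k V]
  [AddCommGroup W] [Module k W]

/-- A linear map of rank at least `r` restricts and projects to the identity of `k^r`. -/
lemma exists_comp_eq_id_of_le_finrank_range [FiniteDimensional k V] (T : V →ₗ[k] W) {r : ℕ}
    (hr : r ≤ Module.finrank k (LinearMap.range T)) :
    ∃ (e : (Fin r → k) →ₗ[k] V) (P : W →ₗ[k] (Fin r → k)), P ∘ₗ T ∘ₗ e = LinearMap.id := by
  obtain ⟨j, hj⟩ : ∃ j : (Fin r → k) →ₗ[k] LinearMap.range T, Function.Injective j := by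
    obtain ⟨b, hb⟩ := exists_linearIndependent_of_le_finrank hr
    exact ⟨Fintype.linearCombination k b,
      linearIndependent_iff_injective_fintypeLinearCombination.1 hb⟩
  obtain ⟨s, hs⟩ := T.rangeRestrict.exists_rightInverse_of_surjective T.range_rangeRestrict
  have hTs : T ∘ₗ s ∘ₗ j = (LinearMap.range T).subtype ∘ₗ j := by
    ext1 i
    ext1
    have := LinearMap.congr_fun hs (j (LinearMap.single k _ i 1))
    exact congrArg Subtype.val this
  obtain ⟨P, hP⟩ := (T ∘ₗ s ∘ₗ j).exists_leftInverse_of_injective (by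
    rw [hTs, LinearMap.ker_eq_bot]
    exact (Submodule.injective_subtype _).comp hj)
  exact ⟨s ∘ₗ j, P, hP⟩

/-- Serves as a converse to the preceding lemma: with `e` and `P` fixed and `T` varying, the
determinant is a minor whose nonvanishing certifies rank at least `r`. -/
lemma le_finrank_range_of_det_ne_zero [FiniteDimensional k V] (T : V →ₗ[k] W) {r : ℕ}
    (e : (Fin r → k) →ₗ[k] V) (P : W →ₗ[k] (Fin r → k))
    (h : (LinearMap.toMatrix' (P ∘ₗ T ∘ₗ e)).det ≠ 0) :
    r ≤ Module.finrank k (LinearMap.range T) := by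
  have hinj : Function.Injective (T ∘ₗ e) := by
    have : Function.Injective (P ∘ₗ T ∘ₗ e) := by
      rw [LinearMap.det_toMatrix'] at h
      exact ((Module.End.isUnit_iff _).1
        ((LinearMap.isUnit_iff_isUnit_det _).2 (isUnit_iff_ne_zero.2 h))).1
    exact Function.Injective.of_comp this
  calc r = Module.finrank k (LinearMap.range (T ∘ₗ e)) := by
        rw [LinearMap.finrank_range_of_inj hinj]; simp
    _ ≤ _ := Submodule.finrank_mono (LinearMap.range_comp_le_range e T)

variable {σ : Type w''} (A : (σ → k) → V →ₗ[k] W)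

/-- The rank of a family of linear maps with regular coefficients is lower semicontinuous for the
Zariski topology. -/
lemma finrank_range_le_of_mem_closure [FiniteDimensional k V]
    (hA : ∀ (l : W →ₗ[k] k) (y : V), IsRegular fun z => l (A z y)) {S : Set (σ → k)} {r : ℕ}
    (hS : ∀ z ∈ S, Module.finrank k (LinearMap.range (A z)) ≤ r) {z : σ → k}
    (hz : z ∈ @closure _ (zariskiTopology k σ) S) :
    Module.finrank k (LinearMap.range (A z)) ≤ r := by
  by_contra! hlt
  -- This gives a minor of size `r + 1` that equals `1` at `z` but vanishes on `S`.
  obtain ⟨e, P, hPe⟩ := exists_comp_eq_id_of_le_finrank_range (A z) (Nat.succ_le_of_lt hlt)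
  have hreg : IsRegular fun z => (LinearMap.toMatrix' (P ∘ₗ A z ∘ₗ e)).det :=
    IsRegular.det fun i j => by
      simpa [LinearMap.toMatrix'_apply] using
        hA (LinearMap.proj i ∘ₗ P) (e (Pi.single j 1))
  have h0 := mem_closure_zariski_iff.1 hz _ hreg fun y hy => by
    by_contra hdet
    have := le_finrank_range_of_det_ne_zero (A y) e P hdet
    have := hS y hy
    omega
  simp [hPe] at h0

/-- Where the rank of a family of linear maps with regular coefficients does not grow, a kernel
vector at one point extends, up to a scalar, to a regular family of kernel vectors. -/
lemma exists_regular_kernel_section [FiniteDimensional k V]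
    (hA : ∀ (l : W →ₗ[k] k) (y : V), IsRegular fun z => l (A z y)) (z₀ : σ → k) (y₀ : V)
    (hy₀ : A z₀ y₀ = 0) :
    ∃ (D : (σ → k) → k) (φ : (σ → k) → V), IsRegular D ∧
      (∀ l : V →ₗ[k] k, IsRegular fun z => l (φ z)) ∧ D z₀ = 1 ∧ φ z₀ = y₀ ∧
      ∀ z, D z ≠ 0 → Module.finrank k (LinearMap.range (A z)) ≤
        Module.finrank k (LinearMap.range (A z₀)) → A z (φ z) = 0 := by
  obtain ⟨r, hr⟩ : ∃ r, r = Module.finrank k (LinearMap.range (A z₀)) := ⟨_, rfl⟩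
  obtain ⟨e, P, hPe⟩ := exists_comp_eq_id_of_le_finrank_range (A z₀) hr.le
  rw [← hr]
  let B : (σ → k) → Matrix (Fin r) (Fin r) k := fun z => LinearMap.toMatrix' (P ∘ₗ A z ∘ₗ e)
  have hBreg : ∀ i j, IsRegular fun z => B z i j := fun i j => by
    simpa [B, LinearMap.toMatrix'_apply] using
      hA (LinearMap.proj i ∘ₗ P) (e (Pi.single j 1))
  have hBe : ∀ z c, P (A z (e c)) = (B z).mulVec c := fun z c => by
    simp [B, LinearMap.toMatrix'_mulVec]
  -- Cramer's rule: `y₀` is corrected by a vector in the range of `e` so that `P ∘ A z` kills it;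
  -- multiplying by `det` replaces the inverse of `B z` by its adjugate and keeps everything
  -- polynomial. At `z₀`, `B` is the identity and the correction is zero.
  refine ⟨fun z => (B z).det,
    fun z => (B z).det • y₀ - e ((B z).adjugate.mulVec (P (A z y₀))),
    IsRegular.det hBreg, fun l => ?_, ?_, ?_, fun z hD hrank => ?_⟩
  · simp only [map_sub, map_smul, smul_eq_mul]
    refine ((IsRegular.det hBreg).mul (.const _)).sub ?_
    have : ∀ z, l (e ((B z).adjugate.mulVec (P (A z y₀)))) =
        ∑ i, (∑ j, (B z).adjugate i j * P (A z y₀) j) * l (e (Pi.single i 1)) := fun z => by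
      have := LinearMap.pi_apply_eq_sum_univ (l ∘ₗ e) ((B z).adjugate.mulVec (P (A z y₀)))
      simp only [LinearMap.comp_apply, smul_eq_mul] at this
      rw [this]
      refine Finset.sum_congr rfl fun i _ => ?_
      congr 3
      funext j
      simp [Pi.single_apply, eq_comm]
    simp only [this]
    exact IsRegular.sum _ fun i => (IsRegular.sum _ fun j =>
      (IsRegular.adjugate hBreg i j).mul (hA (LinearMap.proj j ∘ₗ P) y₀)).mul (.const _)
  · simp [B, hPe]
  · simp [B, hPe, hy₀]
  · have hPzero : P (A z ((B z).det • y₀ - e ((B z).adjugate.mulVec (P (A z y₀))))) = 0 := by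
      rw [map_sub, map_sub, hBe, Matrix.mulVec_mulVec, Matrix.mul_adjugate]
      simp [Matrix.smul_mulVec]
    -- Where `B z` is invertible, `P` maps the range of `A z` onto `k^r`. The rank being at most
    -- `r`, this is injective, so `P` detects zero on the range.
    let R : LinearMap.range (A z) →ₗ[k] (Fin r → k) := P ∘ₗ (LinearMap.range (A z)).subtype
    have hRsurj : Function.Surjective R := fun c => by
      refine ⟨⟨A z (e ((B z)⁻¹.mulVec c)), LinearMap.mem_range_self _ _⟩, ?_⟩
      change P (A z (e _)) = c
      rw [hBe, Matrix.mulVec_mulVec, Matrix.mul_nonsing_inv _ (isUnit_iff_ne_zero.2 hD),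
        Matrix.one_mulVec]
    have hfin : Module.finrank k (LinearMap.range (A z)) = Module.finrank k (Fin r → k) := by
      refine le_antisymm (by simpa using hrank) ?_
      exact LinearMap.finrank_le_finrank_of_surjective hRsurj
    have hRinj : Function.Injective R :=
      (LinearMap.injective_iff_surjective_of_finrank_eq_finrank hfin).2 hRsurj
    have := @hRinj ⟨_, LinearMap.mem_range_self (A z) _⟩ 0 (hPzero.trans (map_zero R).symm)
    exact congrArg Subtype.val this

end KernelSection

/-! ### Isomorphisms and scaling of representations, and the base point of the orbit. -/

section Representations

variable {k : Type x} [Field k] {Q : Type u} [Quiver.{v} Q]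

namespace QRep

lemma Isomorphic.symm {M : QRep.{u, v, w} k Q} {N : QRep.{u, v, w'} k Q}
    (h : M.Isomorphic N) : N.Isomorphic M := by
  obtain ⟨h, hb⟩ := h
  refine ⟨⟨fun i => (LinearEquiv.ofBijective (h.app i) (hb i)).symm, fun {a b} α => ?_⟩,
    fun i => LinearEquiv.bijective _⟩
  refine LinearMap.ext fun y => ?_
  obtain ⟨y, rfl⟩ := (hb a).2 y
  have := LinearMap.congr_fun (h.comm α) y
  simp only [LinearMap.comp_apply, LinearEquiv.coe_coe] at this ⊢
  rw [← this, LinearEquiv.ofBijective_symm_apply_apply, LinearEquiv.ofBijective_symm_apply_apply]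

lemma Isomorphic.trans {M : QRep.{u, v, w} k Q} {N : QRep.{u, v, w'} k Q}
    {L : QRep.{u, v, w''} k Q} (h : M.Isomorphic N) (h' : N.Isomorphic L) : M.Isomorphic L := by
  obtain ⟨h, hb⟩ := h
  obtain ⟨h', hb'⟩ := h'
  refine ⟨⟨fun i => h'.app i ∘ₗ h.app i, fun {a b} α => ?_⟩, fun i => (hb' i).comp (hb i)⟩
  rw [LinearMap.comp_assoc, h.comm, ← LinearMap.comp_assoc, h'.comm, LinearMap.comp_assoc]

lemma Isomorphic.scale {M : QRep.{u, v, w} k Q} {N : QRep.{u, v, w'} k Q}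
    (h : M.Isomorphic N) (t : k) : (M.scale t).Isomorphic (N.scale t) := by
  obtain ⟨h, hb⟩ := h
  refine ⟨⟨h.app, fun {a b} α => ?_⟩, hb⟩
  change h.app b ∘ₗ (t • M.map α) = (t • N.map α) ∘ₗ h.app a
  rw [LinearMap.comp_smul, LinearMap.smul_comp, h.comm]

end QRep

/-- The map of the arrow `α` as a linear function of the point of `rep(Q, d)`. -/
def RepSpace.arrowMap (k : Type x) [Field k] (d : Q → ℕ) {a b : Q} (α : a ⟶ b) :
    RepSpace k d →ₗ[k] (Fin (d a) → k) →ₗ[k] (Fin (d b) → k) :=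
  Matrix.mulVecBilin k k ∘ₗ
    { toFun := fun m => Matrix.of fun i j => m ⟨a, b, α, i, j⟩
      map_add' := fun _ _ => rfl
      map_smul' := fun _ _ => rfl }

lemma RepSpace.toQRep_smul_isomorphic {d : Q → ℕ} (t : k) (n : RepSpace k d) :
    (t • n).toQRep.Isomorphic (n.toQRep.scale t) := by
  refine ⟨⟨fun _ => LinearMap.id, fun {a b} α => ?_⟩, fun _ => Function.bijective_id⟩
  exact map_smul (RepSpace.arrowMap k d α) t n

variable (M : QRep.{u, v, w} k Q)

/-- An identification of the space of `M` at a vertex with the standard space. -/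
noncomputable def QRep.coordEquiv (i : Q) : M.V i ≃ₗ[k] (Fin (M.dimVec i) → k) :=
  (Module.finBasis k (M.V i)).equivFun

/-- The point of the representation space given by `M` in fixed bases. -/
noncomputable def QRep.basePoint : RepSpace k M.dimVec := fun c =>
  LinearMap.toMatrix' ((M.coordEquiv c.2.1).toLinearMap ∘ₗ M.map c.2.2.1 ∘ₗ
    (M.coordEquiv c.1).symm.toLinearMap) c.2.2.2.1 c.2.2.2.2

lemma QRep.basePoint_map {a b : Q} (α : a ⟶ b) :
    M.basePoint.toQRep.map α = (M.coordEquiv b).toLinearMap ∘ₗ M.map α ∘ₗ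
      (M.coordEquiv a).symm.toLinearMap :=
  Matrix.toLin'_toMatrix' ((M.coordEquiv b).toLinearMap ∘ₗ M.map α ∘ₗ
    (M.coordEquiv a).symm.toLinearMap)

lemma QRep.coordEquiv_comm {a b : Q} (α : a ⟶ b) :
    (M.coordEquiv b).toLinearMap ∘ₗ M.map α =
      M.basePoint.toQRep.map α ∘ₗ (M.coordEquiv a).toLinearMap := by
  rw [M.basePoint_map]
  refine LinearMap.ext fun y => ?_
  change _ = M.coordEquiv b (M.map α ((M.coordEquiv a).symm (M.coordEquiv a y)))
  rw [LinearEquiv.symm_apply_apply]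
  rfl

lemma QRep.basePoint_mem_orbit : M.basePoint ∈ M.orbit :=
  QRep.Isomorphic.symm
    ⟨⟨fun i => (M.coordEquiv i).toLinearMap, M.coordEquiv_comm⟩,
      fun i => (M.coordEquiv i).bijective⟩

lemma QRep.smul_mem_orbit_scale {n : RepSpace k M.dimVec} (hn : n ∈ M.orbit) (t : k) :
    (t • n).toQRep.Isomorphic (M.scale t) :=
  (RepSpace.toQRep_smul_isomorphic t n).trans (QRep.Isomorphic.scale hn t)

/-! ### Morphisms from `M` as a regular family of kernels. -/

/-- The linear map whose kernel is the space of morphisms from `M` to the representation of a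
point of the representation space. -/
noncomputable def QRep.homDefect (n : RepSpace k M.dimVec) :
    (∀ i, M.V i →ₗ[k] (Fin (M.dimVec i) → k)) →ₗ[k]
      (∀ c : (Σ a b : Q, (a ⟶ b)), M.V c.1 →ₗ[k] (Fin (M.dimVec c.2.1) → k)) :=
  LinearMap.pi fun c =>
    LinearMap.lcomp k _ (M.map c.2.2) ∘ₗ LinearMap.proj c.2.1 -
      LinearMap.llcomp k _ _ _ (RepSpace.arrowMap k M.dimVec c.2.2 n) ∘ₗ LinearMap.proj c.1

lemma QRep.homDefect_apply (n : RepSpace k M.dimVec)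
    (φ : ∀ i, M.V i →ₗ[k] (Fin (M.dimVec i) → k)) (c : Σ a b : Q, (a ⟶ b)) :
    M.homDefect n φ c = φ c.2.1 ∘ₗ M.map c.2.2 -
      RepSpace.arrowMap k M.dimVec c.2.2 n ∘ₗ φ c.1 := rfl

/-- For fixed `φ` the defect is affine in `n`: a constant minus a linear function of finitely many
coordinates. -/
lemma QRep.isRegular_homDefect [Finite Q] [∀ a b : Q, Finite (a ⟶ b)]
    (l : (∀ c : (Σ a b : Q, (a ⟶ b)), M.V c.1 →ₗ[k] (Fin (M.dimVec c.2.1) → k)) →ₗ[k] k)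
    (φ : ∀ i, M.V i →ₗ[k] (Fin (M.dimVec i) → k)) :
    IsRegular fun n => l (M.homDefect n φ) := by
  let L : RepSpace k M.dimVec →ₗ[k]
      (∀ c : (Σ a b : Q, (a ⟶ b)), M.V c.1 →ₗ[k] (Fin (M.dimVec c.2.1) → k)) :=
    LinearMap.pi fun c => LinearMap.lcomp k _ (φ c.1) ∘ₗ RepSpace.arrowMap k M.dimVec c.2.2
  have h : ∀ n, l (M.homDefect n φ) =
      l (fun c => φ c.2.1 ∘ₗ M.map c.2.2) - (l ∘ₗ L) n := fun n => by
    rw [LinearMap.comp_apply, ← map_sub]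
    rfl
  simp only [h]
  exact (IsRegular.const _).sub (IsRegular.linear _)

lemma QRep.finrank_range_homDefect_le [Finite Q] [∀ a b : Q, Finite (a ⟶ b)]
    {m n : RepSpace k M.dimVec} (h : m.toQRep.Isomorphic n.toQRep) :
    Module.finrank k (LinearMap.range (M.homDefect n)) ≤
      Module.finrank k (LinearMap.range (M.homDefect m)) := by
  obtain ⟨h, hb⟩ := h
  let app : ∀ i, (Fin (M.dimVec i) → k) →ₗ[k] (Fin (M.dimVec i) → k) := h.app
  let H' : (∀ c : (Σ a b : Q, (a ⟶ b)), M.V c.1 →ₗ[k] (Fin (M.dimVec c.2.1) → k)) →ₗ[k]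
      (∀ c : (Σ a b : Q, (a ⟶ b)), M.V c.1 →ₗ[k] (Fin (M.dimVec c.2.1) → k)) :=
    LinearMap.pi fun c => LinearMap.llcomp k _ _ _ (app c.2.1) ∘ₗ LinearMap.proj c
  have hle : LinearMap.range (M.homDefect n) ≤ (LinearMap.range (M.homDefect m)).map H' := by
    rintro _ ⟨φ, rfl⟩
    -- The defect of `φ` at `n` is `h` composed with the defect of `h⁻¹ ∘ φ` at `m`.
    refine ⟨M.homDefect m fun i => (LinearEquiv.ofBijective (app i) (hb i)).symm.toLinearMap ∘ₗ φ i,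
      LinearMap.mem_range_self _ _, ?_⟩
    funext c
    change app c.2.1 ∘ₗ (M.homDefect m _ c) = M.homDefect n φ c
    rw [QRep.homDefect_apply, QRep.homDefect_apply]
    refine LinearMap.ext fun y => ?_
    have hc : ∀ y, app c.2.1 (RepSpace.arrowMap k M.dimVec c.2.2 m y) =
      RepSpace.arrowMap k M.dimVec c.2.2 n (app c.1 y) := LinearMap.congr_fun (h.comm c.2.2)
    have hs : ∀ i y, app i ((LinearEquiv.ofBijective (app i) (hb i)).symm y) = y :=
      fun i y => (LinearEquiv.ofBijective (app i) (hb i)).apply_symm_apply y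
    simp [hc, hs]
  exact (Submodule.finrank_mono hle).trans (Submodule.finrank_map_le _ _)

/-- The orbit of `M` contains a neighbourhood of the base point in the orbit closure. -/
lemma QRep.exists_regular_of_mem_orbitClosure [Finite Q] [∀ a b : Q, Finite (a ⟶ b)] :
    ∃ f : RepSpace k M.dimVec → k, IsRegular f ∧ f M.basePoint ≠ 0 ∧
      ∀ n ∈ M.orbitClosure, f n ≠ 0 → n ∈ M.orbit := by
  classical
  have := Fintype.ofFinite Q
  obtain ⟨D, φ, hD, hφ, hD0, hφ0, hker⟩ := exists_regular_kernel_section M.homDefect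
    M.isRegular_homDefect M.basePoint (fun i => (M.coordEquiv i).toLinearMap) (by
      funext c
      rw [QRep.homDefect_apply]
      exact sub_eq_zero.2 (M.coordEquiv_comm c.2.2))
  -- Undoing the coordinates turns `φ n` into endomorphisms, which have determinants; at the base
  -- point they are identities.
  let E : RepSpace k M.dimVec → ∀ i, (Fin (M.dimVec i) → k) →ₗ[k] (Fin (M.dimVec i) → k) :=
    fun n i => φ n i ∘ₗ (M.coordEquiv i).symm.toLinearMap
  refine ⟨fun n => D n * ∏ i, (LinearMap.toMatrix' (E n i)).det,
    hD.mul (IsRegular.prod _ fun i => IsRegular.det fun a b => ?_), ?_, fun n hn hf => ?_⟩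
  · exact hφ (LinearMap.proj a ∘ₗ LinearMap.applyₗ ((M.coordEquiv i).symm (Pi.single b 1)) ∘ₗ
      LinearMap.proj i)
  · simp [hD0, E, hφ0]
  -- Points of the orbit are isomorphic to the base point, so the rank bound holds there and passes
  -- to the closure. Then `D n ≠ 0` makes `φ n` a morphism, and the determinants make it invertible.
  · have hrank := finrank_range_le_of_mem_closure M.homDefect M.isRegular_homDefect
      (fun z hz => M.finrank_range_homDefect_le
        (M.basePoint_mem_orbit.trans (QRep.Isomorphic.symm hz))) hn
    have hzero := hker n (left_ne_zero_of_mul hf) hrank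
    refine QRep.Isomorphic.symm ⟨⟨φ n, fun {a b} α => ?_⟩, fun i => ?_⟩
    · exact sub_eq_zero.1 (congrFun hzero ⟨a, b, α⟩)
    · have hdet := Finset.prod_ne_zero_iff.1 (right_ne_zero_of_mul hf) i (Finset.mem_univ i)
      rw [LinearMap.det_toMatrix'] at hdet
      have hE : Function.Bijective (E n i) :=
        (Module.End.isUnit_iff _).1
          ((LinearMap.isUnit_iff_isUnit_det _).2 (isUnit_iff_ne_zero.2 hdet))
      have : ⇑(φ n i) = E n i ∘ M.coordEquiv i := by
        funext y
        simp [E]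
      exact this ▸ hE.comp (M.coordEquiv i).bijective

lemma QRep.isomorphic_scale_of_isHomogeneous [Finite Q] [∀ a b : Q, Finite (a ⟶ b)]
    (hM : M.IsHomogeneous) {t : k} (ht : t ≠ 0) : (M.scale t).Isomorphic M := by
  have hsub : ∀ n ∈ M.orbit, ∀ s : k, s • n ∈ M.orbitClosure := fun n hn s =>
    hM n (mem_closure_zariski_iff.2 fun f _ h => h n hn)
      (Submodule.smul_mem _ s (Submodule.mem_span_singleton_self n))
  obtain ⟨f, hf, hf0, horb⟩ := M.exists_regular_of_mem_orbitClosure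
  -- Otherwise `z ↦ f (t • z)` vanishes on the orbit, hence at `t⁻¹ • M.basePoint`, which the cone
  -- property puts in the closure; this contradicts `hf0`.
  obtain ⟨p, hp, hfp⟩ : ∃ p ∈ M.orbit, f (t • p) ≠ 0 := by
    by_contra! h
    have := mem_closure_zariski_iff.1 (hsub _ M.basePoint_mem_orbit t⁻¹) _ (hf.comp_smul t) h
    exact hf0 (by simpa [smul_smul, ht] using this)
  exact (M.smul_mem_orbit_scale hp t).symm.trans (horb _ (hsub p hp t) hfp)

lemma QRep.isHomogeneous_of_isomorphic_scale [Infinite k]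
    (h : ∀ t : k, t ≠ 0 → (M.scale t).Isomorphic M) : M.IsHomogeneous := by
  intro n hn y hy
  obtain ⟨t, rfl⟩ := Submodule.mem_span_singleton.1 hy
  refine mem_closure_zariski_iff.2 fun f hf hfo => ?_
  have hne : ∀ s : k, s ≠ 0 → f (s • n) = 0 := fun s hs =>
    mem_closure_zariski_iff.1 hn _ (hf.comp_smul s) fun p hp =>
      hfo _ ((M.smul_mem_orbit_scale hp s).trans (h s hs))
  obtain ⟨p, hp⟩ := hf
  -- The restriction of `f` to the line `s ↦ s • n`; it has every nonzero scalar as a root, so it is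
  -- zero and also vanishes at `s = 0`.
  let q : Polynomial k := MvPolynomial.aeval (fun c => Polynomial.C (n c) * Polynomial.X) p
  have hq : ∀ s, q.eval s = f (s • n) := fun s => by
    rw [← hp, ← Polynomial.coe_evalRingHom]
    change Polynomial.evalRingHom s (MvPolynomial.eval₂ _ _ p) = _
    rw [MvPolynomial.hom_eval₂, MvPolynomial.eval, MvPolynomial.coe_eval₂Hom]
    congr 1
    · ext; simp
    · funext c
      change Polynomial.eval s (Polynomial.C (n c) * Polynomial.X) = s * n c
      rw [Polynomial.eval_mul, Polynomial.eval_C, Polynomial.eval_X, mul_comm]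
  have hq0 : q = 0 := by
    refine Polynomial.eq_zero_of_infinite_isRoot q ?_
    exact (Set.finite_singleton (0 : k)).infinite_compl.mono fun s hs => (hq s).trans (hne s hs)
  rw [← hq, hq0, Polynomial.eval_zero]

end Representations

end QuiverCone

theorem mainTheorem4 {k : Type*} [Field k] [IsAlgClosed k] {Q : Type*} [Quiver Q] [Finite Q]
    [∀ a b : Q, Finite (a ⟶ b)] (I : QuiverCone.HomogeneousIdeal k Q)
    (M : QuiverCone.BoundRep I) :
    M.toQRep.IsHomogeneous ↔
      ∀ t : k, t ≠ 0 → QuiverCone.QRep.Isomorphic (M.scale t).toQRep M.toQRep := by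
  have : Infinite k := inferInstance
  exact ⟨fun h _ ht => M.toQRep.isomorphic_scale_of_isHomogeneous h ht,
    M.toQRep.isHomogeneous_of_isomorphic_scale⟩
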